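/- Let $r\in\mathbb N$ and $[r]=\{1,\ldots,r\}$. For $F\subseteq[r]$ let $\Delta_F=\{x\in\mathbb R^r : x_i\ge 0 \text{ for all } i,\ x_1+\cdots+x_r=1,\ x_i=0 \text{ for } i\notin F\}$, and for a finite family $\mathcal F=(F_1,\ldots,F_m)$ of (not necessarily distinct) subsets of $[r]$ let $P_{\mathcal F}=\Delta_{F_1}+\cdots+\Delta_{F_m}$ be the Minkowski sum. A face of $P_{\mathcal F}$ is the set of maximizers on $P_{\mathcal F}$ of a linear function; the degree of a vertex $u$ of $P_{\mathcal F}$ is the number of edges (one-dimensional faces) of $P_{\mathcal F}$ that contain $u$, and $\deg_{\max}(P_{\mathcal F})$ is the largest degree of a vertex of $P_{\mathcal F}$ (taken to be $0$ if $P_{\mathcal F}=\emptyset$). For $k\in\mathbb N$ put $$d_k(r)=\max_{|\mathcal F|\le k}\deg_{\max}(P_{\mathcal F}),$$ the maximum being over all families of at most $k$ subsets of $[r]$, counted with multiplicity. Then for every $k\in\{1,\ldots,\lfloor r/2\rfloor\}$, $$d_k(r)=k(r-k).$$ -/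

import Mathlib

namespace MinkowskiSimplices

/-- The face `Δ_F` of the standard simplex in `ℝ^r` spanned by the unit vectors indexed by `F`
(it is empty when `F` is empty). -/
def simplexFace {r : ℕ} (F : Finset (Fin r)) : Set (Fin r → ℝ) :=
  {x | x ∈ stdSimplex ℝ (Fin r) ∧ ∀ i, i ∉ F → x i = 0}

/-- The Minkowski sum `P_𝓕 = Δ_{F_1} + ⋯ + Δ_{F_m}`, where repetitions among the `F_j` are
allowed. -/
def minkowskiSum {r m : ℕ} (F : Fin m → Finset (Fin r)) : Set (Fin r → ℝ) :=
  {x | ∃ y : Fin m → (Fin r → ℝ), (∀ j, y j ∈ simplexFace (F j)) ∧ x = ∑ j, y j}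

/-- The graph of a polytope `P`, where the faces of `P` are the sets of maximizers of linear
functions on `P`. Its vertices are the zero-dimensional faces, and two distinct vertices are
adjacent when the segment that joins them is a face. -/
def polytopeGraph {r : ℕ} (P : Set (Fin r → ℝ)) : SimpleGraph (P.exposedPoints ℝ) where
  Adj u v := u ≠ v ∧ IsExposed ℝ P (segment ℝ (u : Fin r → ℝ) v)
  symm := ⟨fun u v h => ⟨h.1.symm, segment_symm ℝ (u : Fin r → ℝ) v ▸ h.2⟩⟩
  loopless := ⟨fun _ h => h.1 rfl⟩

/-- The maximum degree of a vertex of `P`, as an extended natural number. -/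
noncomputable def maxDegree {r : ℕ} (P : Set (Fin r → ℝ)) : ℕ∞ :=
  ⨆ u : P.exposedPoints ℝ, ((polytopeGraph P).neighborSet u).encard

end MinkowskiSimplices

/-! A vertex of the sum selects from each `F j` the unique index `a j` maximizing a linear function
`l`, and each edge there points along `e_c - e_b` with `b = a j` and `c ∈ F j` (`exists_isEdgeDir`).
Distinct edges have distinct directions, so it suffices to count the pairs `(b, c)`.

These pairs form an oriented graph on `[r]` whose arcs start in the set `A` of selected indices,
`|A| ≤ k`. It has no triangle: `e_z - e_x = (e_z - e_y) + (e_y - e_x)` cannot be an edge direction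
if both summands are (`IsEdgeDir.not_shortcut`), and `l` decreases along arcs, so there are no
cycles. A Mantel-type count (`exists_card_le_of_triangleFree`) gives at most `α (r - α)` arcs with
`α ≤ k ≤ r / 2`, hence at most `k (r - k)`.

Equality holds for the sets `{j} ∪ {k, …, r - 1}`, where every exchange of some `j < k` for some `i
≥ k` is an edge (`le_maxDegree_extremalFamily`). -/

namespace MinkowskiSimplices

open Finset

/-! ### Counting arcs of a triangle-free oriented graph. -/

section Combinatorics

variable {V : Type*} [Fintype V] [DecidableEq V]

/-- A triangle-free oriented graph on `V` whose arcs all start in `A` has at most `α (|V| - α)`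
arcs, for some `α ≤ |A|`: take for `α` the independence number of `A`. -/
lemma exists_card_le_of_triangleFree (E : Finset (V × V)) (A : Finset V)
    (hA : ∀ p ∈ E, p.1 ∈ A) (hasymm : ∀ x y, (x, y) ∈ E → (y, x) ∉ E)
    (htri : ∀ x y z, ((x, y) ∈ E ∨ (y, x) ∈ E) → ((y, z) ∈ E ∨ (z, y) ∈ E) →
      ((x, z) ∈ E ∨ (z, x) ∈ E) → False) :
    ∃ n ≤ #A, #E ≤ n * (Fintype.card V - n) := by
  classical
  let indep : Finset (Finset V) := A.powerset.filter fun I => ∀ x ∈ I, ∀ y ∈ I, (x, y) ∉ E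
  have hne : indep.Nonempty := ⟨∅, by simp [indep]⟩
  obtain ⟨I, hI, hmax⟩ := indep.exists_max_image card hne
  have hI' := hI
  simp only [indep, mem_filter, mem_powerset] at hI'
  obtain ⟨hIA, hIind⟩ := hI'
  refine ⟨#I, card_le_card hIA, ?_⟩
  -- Neighbours of `v` inside `A`: independent because there are no triangles, so at most `#I` many.
  let N : V → Finset V := fun v => A.filter fun x => (x, v) ∈ E ∨ (v, x) ∈ E
  have hN : ∀ v, #(N v) ≤ #I := by
    intro v
    refine hmax _ ?_
    simp only [indep, N, mem_filter, mem_powerset, filter_subset, true_and]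
    rintro x ⟨-, hx⟩ y ⟨-, hy⟩ hxy
    exact htri x y v (Or.inl hxy) hy hx
  have hcard : #E ≤ #(Iᶜ.sigma N) := by
    -- No arc lies inside `I`, so each can be charged to an endpoint outside `I`: the head if
    -- possible, otherwise the tail. The other endpoint lies in `A` either way. Two arcs could
    -- collide only by being mutually reverse.
    refine card_le_card_of_injOn
      (fun p => if p.2 ∈ I then ⟨p.1, p.2⟩ else ⟨p.2, p.1⟩) ?_ ?_
    · rintro ⟨a, i⟩ hp
      have hp : (a, i) ∈ E := hp
      have ha : a ∈ A := hA _ hp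
      by_cases hi : i ∈ I
      · have : a ∉ I := fun h => hIind a h i hi hp
        simp [hi, N, this, hp, hIA hi]
      · simp [hi, N, ha, hp]
    · rintro ⟨a, i⟩ hp ⟨b, j⟩ hq h
      have hp : (a, i) ∈ E := hp
      have hq : (b, j) ∈ E := hq
      by_cases hi : i ∈ I <;> by_cases hj : j ∈ I <;> simp [hi, hj] at h
      · simp [h]
      · obtain ⟨rfl, rfl⟩ := h
        exact (hasymm _ _ hp hq).elim
      · obtain ⟨rfl, rfl⟩ := h
        exact (hasymm _ _ hp hq).elim
      · simp [h]
  calc #E ≤ #(Iᶜ.sigma N) := hcard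
    _ = ∑ v ∈ Iᶜ, #(N v) := card_sigma _ _
    _ ≤ #Iᶜ * #I := by simpa using sum_le_card_nsmul Iᶜ (fun v => #(N v)) #I fun v _ => hN v
    _ = #I * (Fintype.card V - #I) := by rw [card_compl, mul_comm]

end Combinatorics

lemma mul_sub_le_mul_sub {n k r : ℕ} (hn : n ≤ k) (hk : k ≤ r / 2) :
    n * (r - n) ≤ k * (r - k) := by
  obtain ⟨d, rfl⟩ := Nat.exists_eq_add_of_le hn
  obtain ⟨c, rfl⟩ : ∃ c, r = 2 * (n + d) + c := Nat.exists_eq_add_of_le (by omega)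
  have h₁ : 2 * (n + d) + c - n = n + 2 * d + c := by omega
  have h₂ : 2 * (n + d) + c - (n + d) = n + d + c := by omega
  rw [h₁, h₂]
  -- The right side exceeds the left by exactly `d² + d c`.
  nlinarith [Nat.zero_le (d * d), Nat.zero_le (d * c)]

variable {r m : ℕ}

/-- The `i`-th unit vector of `ℝ^r`. -/
abbrev unitVec (i : Fin r) : Fin r → ℝ := Pi.single i 1

/-- The linear function on `ℝ^r` with coefficients `w`. -/
noncomputable def ofWeights (w : Fin r → ℝ) : StrongDual ℝ (Fin r → ℝ) :=
  LinearMap.toContinuousLinearMap (∑ i, w i • LinearMap.proj i)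

lemma ofWeights_unitVec (w : Fin r → ℝ) (i : Fin r) : ofWeights w (unitVec i) = w i := by
  simp [ofWeights, Pi.single_apply]

lemma apply_eq_sum (l : StrongDual ℝ (Fin r → ℝ)) (x : Fin r → ℝ) :
    l x = ∑ i, x i * l (unitVec i) := by
  conv_lhs => rw [pi_eq_sum_univ' x]
  simp [map_sum, unitVec]

lemma unitVec_mem_simplexFace {F : Finset (Fin r)} {i : Fin r} (hi : i ∈ F) :
    unitVec i ∈ simplexFace F := by
  refine ⟨single_mem_stdSimplex ℝ i, fun j hj => ?_⟩
  exact Pi.single_eq_of_ne (fun h : j = i => hj (h ▸ hi)) _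

/-! ### Maximizers on a single simplex. -/

section Face

variable {F : Finset (Fin r)} {y : Fin r → ℝ} {l : StrongDual ℝ (Fin r → ℝ)} {a : Fin r}

lemma mul_apply_le (hy : y ∈ simplexFace F) (h : ∀ i ∈ F, l (unitVec i) ≤ l (unitVec a))
    (i : Fin r) : y i * l (unitVec i) ≤ y i * l (unitVec a) := by
  by_cases hi : i ∈ F
  · exact mul_le_mul_of_nonneg_left (h i hi) (hy.1.1 i)
  · simp [hy.2 i hi]

lemma sum_mul_apply (hy : y ∈ simplexFace F) :
    ∑ i, y i * l (unitVec a) = l (unitVec a) := by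
  rw [← sum_mul, hy.1.2, one_mul]

lemma apply_le_of_mem_simplexFace (hy : y ∈ simplexFace F)
    (h : ∀ i ∈ F, l (unitVec i) ≤ l (unitVec a)) : l y ≤ l (unitVec a) := by
  rw [apply_eq_sum l y, ← sum_mul_apply (l := l) (a := a) hy]
  exact sum_le_sum fun i _ => mul_apply_le hy h i

/-- A maximizer of a linear function on `Δ_F` is supported on the maximizing indices. -/
lemma eq_zero_of_apply_lt (hy : y ∈ simplexFace F)
    (h : ∀ i ∈ F, l (unitVec i) ≤ l (unitVec a)) (hl : l y = l (unitVec a))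
    {i : Fin r} (hi : l (unitVec i) < l (unitVec a)) : y i = 0 := by
  rw [apply_eq_sum l y, ← sum_mul_apply (l := l) (a := a) hy] at hl
  have := (sum_eq_sum_iff_of_le fun i _ => mul_apply_le hy h i).1 hl i (mem_univ i)
  by_contra h0
  exact hi.ne (mul_left_cancel₀ h0 this)

lemma eq_unitVec_of_forall_ne (hy : y ∈ simplexFace F) (h : ∀ i, i ≠ a → y i = 0) :
    y = unitVec a := by
  have h1 : y a = 1 := by
    rw [← hy.1.2]
    exact (sum_eq_single a (fun i _ hi => h i hi) (by simp)).symm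
  ext i
  by_cases hi : i = a
  · subst hi; simp [h1]
  · simp [h i hi, hi]

/-- The strict maximizer of a linear function on `Δ_F` is unique. -/
lemma eq_unitVec_of_apply_eq (hy : y ∈ simplexFace F)
    (h : ∀ i ∈ F, i ≠ a → l (unitVec i) < l (unitVec a)) (hl : l y = l (unitVec a)) :
    y = unitVec a := by
  have hle : ∀ i ∈ F, l (unitVec i) ≤ l (unitVec a) := fun i hi => by
    by_cases hia : i = a
    · rw [hia]
    · exact (h i hi hia).le
  refine eq_unitVec_of_forall_ne hy fun i hia => ?_
  by_cases hi : i ∈ F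
  · exact eq_zero_of_apply_lt hy hle hl (h i hi hia)
  · exact hy.2 i hi

end Face

/-! ### Vertices of the Minkowski sum. -/

section Sum

variable {F : Fin m → Finset (Fin r)} {a : Fin m → Fin r} {l : StrongDual ℝ (Fin r → ℝ)}

/-- The sum of unit vectors selected by `a`. -/
def vertexOf (a : Fin m → Fin r) : Fin r → ℝ := ∑ j, unitVec (a j)

lemma apply_vertexOf : l (vertexOf a) = ∑ j, l (unitVec (a j)) := by
  simp only [vertexOf, map_sum]

lemma vertexOf_mem (ha : ∀ j, a j ∈ F j) : vertexOf a ∈ minkowskiSum F :=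
  ⟨fun j => unitVec (a j), fun j => unitVec_mem_simplexFace (ha j), rfl⟩

lemma vertexOf_update (j : Fin m) (i : Fin r) :
    vertexOf (Function.update a j i) = vertexOf a + (unitVec i - unitVec (a j)) := by
  have : ∀ t, unitVec (Function.update a j i t)
      = unitVec (a t) + if t = j then unitVec i - unitVec (a j) else 0 := by
    intro t
    by_cases h : t = j
    · subst h; simp
    · simp [h]
  simp only [vertexOf, this, sum_add_distrib, sum_ite_eq', mem_univ, if_true]

lemma update_mem (ha : ∀ j, a j ∈ F j) {j : Fin m} {i : Fin r} (hi : i ∈ F j) (t : Fin m) :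
    Function.update a j i t ∈ F t := by
  by_cases h : t = j
  · subst h; simpa using hi
  · simpa [h] using ha t

lemma add_sub_mem (ha : ∀ j, a j ∈ F j) {j : Fin m} {i : Fin r} (hi : i ∈ F j) :
    vertexOf a + (unitVec i - unitVec (a j)) ∈ minkowskiSum F := by
  rw [← vertexOf_update]
  exact vertexOf_mem (update_mem ha hi)

lemma apply_le_vertexOf (h : ∀ j, ∀ i ∈ F j, l (unitVec i) ≤ l (unitVec (a j)))
    {x : Fin r → ℝ} (hx : x ∈ minkowskiSum F) : l x ≤ l (vertexOf a) := by
  obtain ⟨y, hy, rfl⟩ := hx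
  rw [apply_vertexOf, map_sum]
  exact sum_le_sum fun j _ => apply_le_of_mem_simplexFace (hy j) (h j)

/-- In a maximizer on the Minkowski sum, every summand is a maximizer. -/
lemma apply_summand_eq (h : ∀ j, ∀ i ∈ F j, l (unitVec i) ≤ l (unitVec (a j)))
    {y : Fin m → Fin r → ℝ} (hy : ∀ j, y j ∈ simplexFace (F j))
    (hl : l (vertexOf a) ≤ l (∑ j, y j)) (j : Fin m) : l (y j) = l (unitVec (a j)) := by
  have heq := hl.antisymm' (apply_le_vertexOf h ⟨y, hy, rfl⟩)
  rw [apply_vertexOf, map_sum] at heq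
  exact (sum_eq_sum_iff_of_le fun j _ => apply_le_of_mem_simplexFace (hy j) (h j)).1 heq j
    (mem_univ j)

lemma le_of_lt_of_ne (h : ∀ j, ∀ i ∈ F j, i ≠ a j → l (unitVec i) < l (unitVec (a j)))
    (j : Fin m) (i : Fin r) (hi : i ∈ F j) : l (unitVec i) ≤ l (unitVec (a j)) := by
  by_cases hia : i = a j
  · rw [hia]
  · exact (h j i hi hia).le

lemma vertexOf_mem_exposedPoints (ha : ∀ j, a j ∈ F j)
    (h : ∀ j, ∀ i ∈ F j, i ≠ a j → l (unitVec i) < l (unitVec (a j))) :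
    vertexOf a ∈ (minkowskiSum F).exposedPoints ℝ := by
  refine ⟨vertexOf_mem ha, l, fun x hx => ⟨apply_le_vertexOf (le_of_lt_of_ne h) hx, fun hl => ?_⟩⟩
  obtain ⟨y, hy, rfl⟩ := hx
  refine sum_congr rfl fun j _ => ?_
  exact eq_unitVec_of_apply_eq (hy j) (h j) (apply_summand_eq (le_of_lt_of_ne h) hy hl j)

/-- Every vertex of the Minkowski sum selects the unique maximizing index in every `F j`. -/
lemma exists_of_mem_exposedPoints {u : Fin r → ℝ} (hu : u ∈ (minkowskiSum F).exposedPoints ℝ) :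
    ∃ (a : Fin m → Fin r) (l : StrongDual ℝ (Fin r → ℝ)), u = vertexOf a ∧ (∀ j, a j ∈ F j) ∧
      ∀ j, ∀ i ∈ F j, i ≠ a j → l (unitVec i) < l (unitVec (a j)) := by
  obtain ⟨huP, l, hl⟩ := hu
  have hne : ∀ j, (F j).Nonempty := by
    obtain ⟨y, hy, -⟩ := huP
    intro j
    rw [nonempty_iff_ne_empty]
    intro h0
    have h1 := (hy j).1.2
    rw [sum_eq_zero fun i _ => (hy j).2 i (by simp [h0])] at h1
    exact zero_ne_one h1
  choose a ha hmax using fun j => (F j).exists_max_image (fun i => l (unitVec i)) (hne j)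
  have hua : vertexOf a = u := (hl _ (vertexOf_mem ha)).2 (apply_le_vertexOf hmax huP)
  refine ⟨a, l, hua.symm, ha, fun j i hi hia => ?_⟩
  -- If `i` did at least as well as `a j`, exchanging them would give another maximizer,
  -- contradicting uniqueness.
  by_contra! hle
  have hx := (hl _ (add_sub_mem ha hi)).2 (by rw [hua, map_add, map_sub]; linarith)
  rw [hua, add_eq_left, sub_eq_zero] at hx
  have := congrFun hx i
  simp [hia] at this

/-! ### Edge directions and the upper bound. -/

/-- The pair `p = (b, c)` is an edge direction at the vertex `vertexOf a`: some linear function is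
maximized at `vertexOf a`, and on the sets `F j` its only tie with `a j` is between `b` and `c`. -/
def IsEdgeDir (F : Fin m → Finset (Fin r)) (a : Fin m → Fin r) (p : Fin r × Fin r) : Prop :=
  (∃ j, a j = p.1 ∧ p.2 ∈ F j) ∧ p.2 ≠ p.1 ∧ ∃ l : StrongDual ℝ (Fin r → ℝ),
    (∀ j, ∀ i ∈ F j, l (unitVec i) ≤ l (unitVec (a j))) ∧
    l (unitVec p.2) = l (unitVec p.1) ∧
    ∀ j, ∀ i ∈ F j, i ≠ a j → l (unitVec i) = l (unitVec (a j)) → (a j, i) = p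

/-- The function for `(x, z)` satisfies `l z ≤ l y ≤ l x = l z`, so `y` also ties with `x`; the only
permitted tie then forces `y = z`. -/
lemma IsEdgeDir.not_shortcut {x y z : Fin r} (hxy : IsEdgeDir F a (x, y))
    (hyz : IsEdgeDir F a (y, z)) (hxz : IsEdgeDir F a (x, z)) : False := by
  obtain ⟨⟨j, rfl, hj⟩, hne, -⟩ := hxy
  obtain ⟨⟨j', rfl, hj'⟩, hne', -⟩ := hyz
  obtain ⟨-, -, l, hle, heq, huniq⟩ := hxz
  have h := huniq j _ hj hne ((hle j _ hj).antisymm (heq.symm.le.trans (hle j' z hj')))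
  exact hne' (Prod.ext_iff.1 h).2.symm

lemma IsEdgeDir.lt {p : Fin r × Fin r}
    (h : ∀ j, ∀ i ∈ F j, i ≠ a j → l (unitVec i) < l (unitVec (a j)))
    (hp : IsEdgeDir F a p) : l (unitVec p.2) < l (unitVec p.1) := by
  obtain ⟨⟨j, hj, hj'⟩, hne, -⟩ := hp
  rw [← hj] at hne ⊢
  exact h j _ hj' hne

/-- There are at most `k (r - k)` edge directions at a vertex. -/
lemma encard_edgeDir_le {k : ℕ} (hm : m ≤ k) (hkr : k ≤ r / 2)
    (h : ∀ j, ∀ i ∈ F j, i ≠ a j → l (unitVec i) < l (unitVec (a j))) :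
    {p | IsEdgeDir F a p}.encard ≤ (k * (r - k) : ℕ) := by
  classical
  let E : Finset (Fin r × Fin r) := univ.filter (IsEdgeDir F a)
  have hE : ∀ p, p ∈ E ↔ IsEdgeDir F a p := by simp [E]
  have hlt : ∀ x y, IsEdgeDir F a (x, y) → l (unitVec y) < l (unitVec x) :=
    fun x y hp => hp.lt h
  obtain ⟨n, hn, hcard⟩ := exists_card_le_of_triangleFree E (univ.image a)
    (fun p hp => by
      obtain ⟨⟨j, hj, -⟩, -⟩ := (hE p).1 hp
      exact mem_image.2 ⟨j, mem_univ j, hj⟩)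
    (fun x y hxy hyx => ((hlt _ _ ((hE _).1 hxy)).trans (hlt _ _ ((hE _).1 hyx))).false)
    (fun x y z hxy hyz hxz => by
      simp only [hE] at hxy hyz hxz
      -- Of the eight orientations, the two cyclic ones contradict the decrease of `l`; the other
      -- six are transitive.
      rcases hxy with hxy | hxy <;> rcases hyz with hyz | hyz <;> rcases hxz with hxz | hxz
      · exact hxy.not_shortcut hyz hxz
      · linarith [hlt _ _ hxy, hlt _ _ hyz, hlt _ _ hxz]
      · exact hxz.not_shortcut hyz hxy
      · exact hxz.not_shortcut hxy hyz
      · exact hxy.not_shortcut hxz hyz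
      · exact hyz.not_shortcut hxz hxy
      · linarith [hlt _ _ hxy, hlt _ _ hyz, hlt _ _ hxz]
      · exact hyz.not_shortcut hxy hxz)
  have hset : {p | IsEdgeDir F a p} = (E : Set (Fin r × Fin r)) := by ext p; simp [E]
  rw [hset, Set.encard_coe_eq_coe_finsetCard, Nat.cast_le]
  rw [Fintype.card_fin] at hcard
  have hnm : n ≤ m := hn.trans (card_image_le.trans (by simp))
  exact hcard.trans (mul_sub_le_mul_sub (hnm.trans hm) hkr)

/-- The edge from `vertexOf a` to `v` points in the edge direction `p`. -/
lemma exists_isEdgeDir (ha : ∀ j, a j ∈ F j) {v : Fin r → ℝ} (hne : vertexOf a ≠ v)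
    (hexp : IsExposed ℝ (minkowskiSum F) (segment ℝ (vertexOf a) v)) :
    ∃ p, IsEdgeDir F a p ∧ ∃ t : ℝ, v = vertexOf a + t • (unitVec p.2 - unitVec p.1) ∧
      ∀ s : ℝ, vertexOf a + s • (unitVec p.2 - unitVec p.1) ∈ minkowskiSum F → s ≤ t := by
  obtain ⟨l, hl⟩ := hexp ⟨_, left_mem_segment ℝ _ v⟩
  have hu : ∀ x ∈ minkowskiSum F, l x ≤ l (vertexOf a) := by
    have := left_mem_segment ℝ (vertexOf a) v
    rw [hl] at this
    exact this.2
  have hseg : ∀ x ∈ minkowskiSum F, l (vertexOf a) ≤ l x → x ∈ segment ℝ (vertexOf a) v := by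
    intro x hx hle
    rw [hl]
    exact ⟨hx, fun y hy => (hu y hy).trans hle⟩
  have hv := right_mem_segment ℝ (vertexOf a) v
  rw [hl] at hv
  have hle : ∀ j, ∀ i ∈ F j, l (unitVec i) ≤ l (unitVec (a j)) := by
    intro j i hi
    have := hu _ (add_sub_mem ha hi)
    rw [map_add, map_sub] at this
    linarith
  -- A tie at `i` puts `vertexOf a + (e_i - e_{a j})` on the edge, so the edge has that direction.
  have htie : ∀ j, ∀ i ∈ F j, i ≠ a j → l (unitVec i) = l (unitVec (a j)) →
      ∃ t : ℝ, 0 < t ∧ v - vertexOf a = t • (unitVec i - unitVec (a j)) := by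
    intro j i hi hia heq
    have hx := hseg _ (add_sub_mem ha hi) (by rw [map_add, map_sub]; linarith)
    rw [segment_eq_image'] at hx
    obtain ⟨θ, hθ, hx⟩ := hx
    have hx := add_left_cancel hx
    have h0 : θ ≠ 0 := by
      rintro rfl
      have := congrFun hx i
      simp [hia] at this
    refine ⟨θ⁻¹, inv_pos.2 (lt_of_le_of_ne hθ.1 h0.symm), ?_⟩
    rw [← hx, smul_smul, inv_mul_cancel₀ h0, one_smul]
  -- Without a tie `vertexOf a` would be the only maximizer, and `v` would coincide with it.
  have hex : ∃ j, ∃ i ∈ F j, i ≠ a j ∧ l (unitVec i) = l (unitVec (a j)) := by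
    by_contra! hcon
    obtain ⟨y, hy, hvy⟩ := hv.1
    have hlv := hv.2 _ (vertexOf_mem ha)
    rw [hvy] at hlv
    refine hne ?_
    rw [hvy]
    refine sum_congr rfl fun j _ => (eq_unitVec_of_apply_eq (hy j) (fun i hi hia => ?_)
      (apply_summand_eq hle hy hlv j)).symm
    exact lt_of_le_of_ne (hle j i hi) (hcon j i hi hia)
  obtain ⟨j, i, hi, hia, heq⟩ := hex
  obtain ⟨t, ht, hvt⟩ := htie j i hi hia heq
  refine ⟨(a j, i), ⟨⟨j, rfl, hi⟩, hia, l, hle, heq, ?_⟩, t, by rw [← hvt]; abel, ?_⟩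
  · intro j' i' hi' hia' heq'
    obtain ⟨t', ht', hvt'⟩ := htie j' i' hi' hia' heq'
    rw [hvt] at hvt'
    have h1 := congrFun hvt' i'
    have h2 := congrFun hvt' (a j')
    simp only [Pi.smul_apply, Pi.sub_apply, Pi.single_apply, smul_eq_mul, if_true, hia',
      if_false, hia'.symm] at h1 h2
    -- Two ties give positive multiples of `e_i - e_{a j}` and `e_{i'} - e_{a j'}` that agree; the
    -- signs of the coordinates identify the indices.
    ext1
    · by_contra hc
      simp only at hc
      rw [if_neg hc] at h2
      split_ifs at h2 <;> linarith
    · by_contra hc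
      simp only at hc
      rw [if_neg hc] at h1
      split_ifs at h1 <;> linarith
  · intro s hs
    have hx := hseg _ hs (by rw [map_add, map_smul, map_sub, heq, sub_self]; simp)
    rw [segment_eq_image'] at hx
    obtain ⟨θ, hθ, hx⟩ := hx
    have hx := congrFun (add_left_cancel hx) i
    rw [hvt] at hx
    simp only [Pi.smul_apply, Pi.sub_apply, Pi.single_apply, smul_eq_mul, if_true, hia,
      if_false] at hx
    nlinarith [hθ.2]

/-- A neighbour is determined by its edge direction, being the last point of the polytope on the ray
in that direction. -/
lemma maxDegree_minkowskiSum_le {k : ℕ} (hm : m ≤ k) (hkr : k ≤ r / 2)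
    (F : Fin m → Finset (Fin r)) : maxDegree (minkowskiSum F) ≤ (k * (r - k) : ℕ) := by
  refine iSup_le fun ⟨u, hu⟩ => ?_
  obtain ⟨a, l, rfl, ha, hl⟩ := exists_of_mem_exposedPoints hu
  have key : ∀ v ∈ (polytopeGraph (minkowskiSum F)).neighborSet ⟨vertexOf a, hu⟩,
      ∃ p, IsEdgeDir F a p ∧ ∃ t : ℝ,
        (v : Fin r → ℝ) = vertexOf a + t • (unitVec p.2 - unitVec p.1) ∧
        ∀ s : ℝ, vertexOf a + s • (unitVec p.2 - unitVec p.1) ∈ minkowskiSum F → s ≤ t :=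
    fun v hv => exists_isEdgeDir ha (fun h => hv.1 (Subtype.ext h)) hv.2
  rcases Set.eq_empty_or_nonempty
    ((polytopeGraph (minkowskiSum F)).neighborSet ⟨vertexOf a, hu⟩) with h0 | ⟨v₀, hv₀⟩
  · simp [h0]
  have : Nonempty (Fin r × Fin r) := ⟨(key v₀ hv₀).choose⟩
  choose! p hp t ht hmax using key
  refine le_trans (Set.encard_le_encard_of_injOn (f := p) (fun v hv => hp v hv) ?_)
    (encard_edgeDir_le hm hkr hl)
  intro v hv v' hv' h
  have h1 := hmax v hv (t v') (by rw [h, ← ht v' hv']; exact v'.2.1)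
  have h2 := hmax v' hv' (t v) (by rw [← h, ← ht v hv]; exact v.2.1)
  refine Subtype.ext ?_
  rw [ht v hv, ht v' hv', h, le_antisymm h1 h2]

/-- If, on the sets `F j`, the only tie of `l` with `a j` is at `i` in `F j₀`, then `l` exposes the
edge from `vertexOf a` in direction `unitVec i - unitVec (a j₀)`. -/
lemma isExposed_segment (ha : ∀ j, a j ∈ F j) {j₀ : Fin m} {i₀ : Fin r} (hi₀ : i₀ ∈ F j₀)
    (hia : i₀ ≠ a j₀) (heq : l (unitVec i₀) = l (unitVec (a j₀)))
    (hne : ∀ j, j ≠ j₀ → ∀ i ∈ F j, i ≠ a j → l (unitVec i) < l (unitVec (a j)))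
    (hj₀ : ∀ i ∈ F j₀, i ≠ a j₀ → i ≠ i₀ → l (unitVec i) < l (unitVec (a j₀))) :
    IsExposed ℝ (minkowskiSum F)
      (segment ℝ (vertexOf a) (vertexOf (Function.update a j₀ i₀))) := by
  intro _
  have hle : ∀ j, ∀ i ∈ F j, l (unitVec i) ≤ l (unitVec (a j)) := by
    intro j i hi
    by_cases h1 : i = a j
    · rw [h1]
    by_cases hj : j = j₀
    · subst hj
      by_cases h2 : i = i₀
      · rw [h2, heq]
      · exact (hj₀ i hi h1 h2).le
    · exact (hne j hj i hi h1).le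
  refine ⟨l, Set.Subset.antisymm ?_ ?_⟩
  · intro x hx
    rw [segment_eq_image', vertexOf_update, add_sub_cancel_left] at hx
    obtain ⟨θ, hθ, rfl⟩ := hx
    have hlx : l (vertexOf a + θ • (unitVec i₀ - unitVec (a j₀))) = l (vertexOf a) := by
      rw [map_add, map_smul, map_sub, heq, sub_self, smul_zero, add_zero]
    refine ⟨?_, fun y hy => (apply_le_vertexOf hle hy).trans hlx.ge⟩
    refine ⟨fun j => unitVec (a j) + if j = j₀ then θ • (unitVec i₀ - unitVec (a j₀)) else 0,
      fun j => ?_, by simp [vertexOf, sum_add_distrib]⟩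
    by_cases hj : j = j₀
    · subst hj
      simp only [if_true]
      have hc : unitVec (a j) + θ • (unitVec i₀ - unitVec (a j))
          = (1 - θ) • unitVec (a j) + θ • unitVec i₀ := by
        rw [sub_smul, one_smul, smul_sub]; abel
      rw [hc]
      refine ⟨convex_stdSimplex ℝ _ (single_mem_stdSimplex ℝ _) (single_mem_stdSimplex ℝ _)
        (by linarith [hθ.2]) hθ.1 (by ring), fun i hi => ?_⟩
      simp [(unitVec_mem_simplexFace (ha j)).2 i hi, (unitVec_mem_simplexFace hi₀).2 i hi]
    · simpa [hj] using unitVec_mem_simplexFace (ha j)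
  · rintro x ⟨⟨y, hy, rfl⟩, hmax⟩
    have hly := apply_summand_eq hle hy (hmax _ (vertexOf_mem ha))
    have hyj : ∀ j, j ≠ j₀ → y j = unitVec (a j) :=
      fun j hj => eq_unitVec_of_apply_eq (hy j) (hne j hj) (hly j)
    have hsupp : ∀ i, i ≠ a j₀ → i ≠ i₀ → y j₀ i = 0 := by
      intro i h1 h2
      by_cases hi : i ∈ F j₀
      · exact eq_zero_of_apply_lt (hy j₀) (hle j₀) (hly j₀) (hj₀ i hi h1 h2)
      · exact (hy j₀).2 i hi
    have hsum : y j₀ (a j₀) + y j₀ i₀ = 1 := by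
      rw [← (hy j₀).1.2, ← sum_pair hia.symm]
      refine sum_subset (subset_univ _) fun i _ hi => ?_
      simp only [mem_insert, mem_singleton, not_or] at hi
      exact hsupp i hi.1 hi.2
    have hyj₀ : y j₀ = unitVec (a j₀) + y j₀ i₀ • (unitVec i₀ - unitVec (a j₀)) := by
      ext i
      by_cases h1 : i = a j₀
      · subst h1; simp [hia.symm]; linarith
      by_cases h2 : i = i₀
      · subst h2; simp [hia]
      simp [h1, h2, hsupp i h1 h2]
    rw [segment_eq_image', vertexOf_update, add_sub_cancel_left]
    refine ⟨y j₀ i₀, ⟨(hy j₀).1.1 _, by linarith [(hy j₀).1.1 (a j₀)]⟩, ?_⟩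
    have : ∀ j, y j = unitVec (a j)
        + if j = j₀ then y j₀ i₀ • (unitVec i₀ - unitVec (a j₀)) else 0 := by
      intro j
      by_cases hj : j = j₀
      · subst hj; simpa using hyj₀
      · simpa [hj] using hyj j hj
    rw [sum_congr rfl fun j _ => this j]
    simp [vertexOf, sum_add_distrib]

end Sum

/-! ### The extremal family. -/

section Extremal

variable {k : ℕ}

/-- The sets `{j} ∪ {k, …, r - 1}` for `j < k`, which attain the maximum degree. -/
def extremalFamily (hkr : k ≤ r) (j : Fin k) : Finset (Fin r) :=
  univ.filter fun i => i = Fin.castLE hkr j ∨ k ≤ (i : ℕ)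

lemma castLE_mem_extremalFamily (hkr : k ≤ r) (j : Fin k) :
    Fin.castLE hkr j ∈ extremalFamily hkr j := by simp [extremalFamily]

lemma mem_extremalFamily_of_le (hkr : k ≤ r) (j : Fin k) {i : Fin r} (hi : k ≤ (i : ℕ)) :
    i ∈ extremalFamily hkr j := by simp [extremalFamily, hi]

lemma le_of_mem_extremalFamily {hkr : k ≤ r} {j : Fin k} {i : Fin r}
    (hi : i ∈ extremalFamily hkr j) (hne : i ≠ Fin.castLE hkr j) : k ≤ (i : ℕ) := by
  simpa [extremalFamily, hne] using hi

lemma le_maxDegree_extremalFamily (hkr : k ≤ r) :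
    ((k * (r - k) : ℕ) : ℕ∞) ≤ maxDegree (minkowskiSum (extremalFamily hkr)) := by
  let a : Fin k → Fin r := Fin.castLE hkr
  have ha : ∀ j, a j ∈ extremalFamily hkr j := castLE_mem_extremalFamily hkr
  have hak : ∀ j, ((a j : Fin r) : ℕ) < k := fun j => j.2
  have hainj : Function.Injective a := Fin.castLE_injective hkr
  have hu : vertexOf a ∈ (minkowskiSum (extremalFamily hkr)).exposedPoints ℝ := by
    refine vertexOf_mem_exposedPoints (l := ofWeights fun i => if (i : ℕ) < k then 1 else 0) ha ?_
    intro j i hi hne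
    have := le_of_mem_extremalFamily hi hne
    simp [ofWeights_unitVec, hak, this.not_gt]
  have hv : ∀ (j : Fin k) (i : Fin r), k ≤ (i : ℕ) → vertexOf (Function.update a j i) ∈
      (minkowskiSum (extremalFamily hkr)).exposedPoints ℝ := by
    intro j₀ i₀ hi₀
    -- All sets contain `i₀`, so it must beat `a j₀` (weight 0) yet lose to every other `a j`
    -- (weight 2).
    refine vertexOf_mem_exposedPoints
      (l := ofWeights fun i => if i = i₀ then 1 else if (i : ℕ) < k ∧ i ≠ a j₀ then 2 else 0)
      (update_mem ha (mem_extremalFamily_of_le hkr j₀ hi₀)) ?_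
    intro j i hi hne
    by_cases hj : j = j₀
    · subst hj
      rw [Function.update_self] at hne ⊢
      have : ¬ ((i : ℕ) < k ∧ i ≠ a j) := fun h =>
        h.1.not_ge (le_of_mem_extremalFamily hi h.2)
      simp only [ofWeights_unitVec, hne, this, if_true, if_false, zero_lt_one]
    · rw [Function.update_of_ne hj] at hne ⊢
      have h1 := le_of_mem_extremalFamily hi hne
      have h2 : a j ≠ i₀ := fun h => by have := hak j; rw [h] at this; omega
      have h3 : ¬ ((i : ℕ) < k ∧ i ≠ a j₀) := fun h => by omega
      have h4 : (a j : ℕ) < k ∧ a j ≠ a j₀ := ⟨hak j, hainj.ne hj⟩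
      simp only [ofWeights_unitVec, if_neg h2, if_neg h3, if_pos h4]
      split_ifs <;> norm_num
  have hadj : ∀ (j : Fin k) (i : Fin r) (hi : k ≤ (i : ℕ)),
      (polytopeGraph (minkowskiSum (extremalFamily hkr))).Adj ⟨vertexOf a, hu⟩
        ⟨vertexOf (Function.update a j i), hv j i hi⟩ := by
    intro j₀ i₀ hi₀
    have hia : i₀ ≠ a j₀ := fun h => by have := hak j₀; rw [← h] at this; omega
    refine ⟨fun h => ?_, ?_⟩
    · have h : vertexOf a i₀ = vertexOf (Function.update a j₀ i₀) i₀ :=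
        congrFun (Subtype.ext_iff.1 h) i₀
      rw [vertexOf_update] at h
      simp [hia] at h
    -- Now `i₀` and `a j₀` tie at weight 1, still below the other `a j`.
    · refine isExposed_segment (l := ofWeights fun i =>
        if i = i₀ ∨ i = a j₀ then 1 else if (i : ℕ) < k then 2 else 0) ha
        (mem_extremalFamily_of_le hkr j₀ hi₀) hia ?_ ?_ ?_
      · simp [ofWeights_unitVec]
      · intro j hj i hi hne
        have h1 := le_of_mem_extremalFamily hi hne
        have h2 : ¬ (a j = i₀ ∨ a j = a j₀) := by
          rintro (h | h)
          · have := hak j; rw [h] at this; omega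
          · exact hj (hainj h)
        simp only [ofWeights_unitVec, if_neg h2, if_neg h1.not_gt, if_pos (hak j)]
        split_ifs <;> norm_num
      · intro i hi h1 h2
        have h3 := le_of_mem_extremalFamily hi h1
        simp [ofWeights_unitVec, h1, h2, h3.not_gt]
  refine le_trans ?_ (le_iSup _ (⟨vertexOf a, hu⟩ :
    (minkowskiSum (extremalFamily hkr)).exposedPoints ℝ))
  let f : Fin k × Fin (r - k) → (minkowskiSum (extremalFamily hkr)).exposedPoints ℝ :=
    fun q => ⟨vertexOf (Function.update a q.1 ⟨k + q.2, by omega⟩), hv _ _ (by simp)⟩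
  have hf : Function.Injective f := by
    rintro ⟨j, i⟩ ⟨j', i'⟩ h
    have h := Subtype.ext_iff.1 h
    simp only [f, vertexOf_update] at h
    have h := add_left_cancel h
    -- The displacement `e_{k+i} - e_{a j}` reveals `i` at its positive coordinate and `j` at its
    -- negative one.
    have h1 := congrFun h ⟨k + i, by omega⟩
    have h2 := congrFun h (a j)
    have e1 : ∀ (x : Fin (r - k)) (y : Fin k), (⟨k + x, by omega⟩ : Fin r) ≠ a y := by
      intro x y hxy
      have := hak y; rw [← hxy] at this; simp at this
    have e2 : ∀ (x : Fin (r - k)) (y : Fin k), a y ≠ (⟨k + x, by omega⟩ : Fin r) :=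
      fun x y => (e1 x y).symm
    simp only [Pi.sub_apply, Pi.single_apply, if_true, e1, e2, if_false] at h1 h2
    have hi : i = i' := by
      by_contra hc
      have : ¬ (k + (i : ℕ) = k + i') := fun h => hc (Fin.ext (by omega))
      simp at h1
      omega
    have hj : j = j' := by
      by_contra hc
      simp [hainj.ne hc] at h2
    rw [hi, hj]
  calc ((k * (r - k) : ℕ) : ℕ∞) = (Set.range f).encard := by
        rw [← Set.image_univ, hf.encard_image, Set.encard_univ]
        simp
    _ ≤ _ := Set.encard_le_encard (by
        rintro _ ⟨q, rfl⟩
        exact hadj q.1 ⟨k + q.2, by omega⟩ (by simp))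

end Extremal

end MinkowskiSimplices

theorem mainTheorem2 (r k : ℕ) (hk : 1 ≤ k) (hkr : k ≤ r / 2) :
    IsGreatest
      {d : ℕ∞ | ∃ m : ℕ, m ≤ k ∧ ∃ F : Fin m → Finset (Fin r),
        d = MinkowskiSimplices.maxDegree (MinkowskiSimplices.minkowskiSum F)}
      ((k * (r - k) : ℕ) : ℕ∞) := by
  refine ⟨⟨k, le_rfl, MinkowskiSimplices.extremalFamily (hkr.trans (Nat.div_le_self r 2)), ?_⟩, ?_⟩
  · exact le_antisymm (MinkowskiSimplices.le_maxDegree_extremalFamily _)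
      (MinkowskiSimplices.maxDegree_minkowskiSum_le le_rfl hkr _)
  · rintro _ ⟨m, hm, F, rfl⟩
    exact MinkowskiSimplices.maxDegree_minkowskiSum_le hm hkr F
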